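/- Let $d\in\mathbb N$, $\sigma,\tau>0$, and let $\mathcal P_2(\mathbb R^d)$ be the set of Borel probability measures on $\mathbb R^d$ with finite second moment, equipped with the 2-Wasserstein distance $\mathcal W_2$. Let $\pi\in\mathcal P_2(\mathbb R^d)$ and $\mathcal P_2^\pi(\mathbb R^d)=\{\mu\in\mathcal P_2(\mathbb R^d):\mu\ll\pi\}$. Let $F:\mathcal P_2(\mathbb R^d)\to\mathbb R$ be of class $\mathcal C^1$, i.e. there is a function $\frac{\delta F}{\delta\mu}:\mathcal P_2(\mathbb R^d)\times\mathbb R^d\to\mathbb R$ (the flat derivative of $F$), continuous for the product topology, and $\kappa>0$ such that $|\frac{\delta F}{\delta\mu}(\mu,x)|\le\kappa(1+|x|^2)$, $\int_{\mathbb R^d}\frac{\delta F}{\delta\mu}(\mu,x)\,\mu(\mathrm dx)=0$ and $$\lim_{\varepsilon\searrow0}\frac{F(\mu+\varepsilon(\mu'-\mu))-F(\mu)}{\varepsilon}=\int_{\mathbb R^d}\frac{\delta F}{\delta\mu}(\mu,x)\,(\mu'-\mu)(\mathrm dx)$$ for all $\mu,\mu'\in\mathcal P_2(\mathbb R^d)$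 and $x\in\mathbb R^d$. Assume that the flat derivative is bounded: there is $C_F>0$ with $|\frac{\delta F}{\delta\mu}(\mu,x)|\le C_F$ for all $\mu\in\mathcal P_2(\mathbb R^d)$, $x\in\mathbb R^d$. Then, for every $\mu^0\in\mathcal P_2^\pi(\mathbb R^d)$, there exists a unique minimizer $\mu^1\in\mathcal P_2^\pi(\mathbb R^d)$ of $$\mathcal P_2^\pi(\mathbb R^d)\ni\mu\mapsto\int_{\mathbb R^d}\frac{\delta F}{\delta\mu}(\mu^0,x)\,(\mu-\mu^0)(\mathrm dx)+\sigma\operatorname{KL}(\mu|\pi)+\frac1{2\tau}\mathcal W_2^2(\mu,\mu^0),$$ where $\operatorname{KL}(\mu|\pi)=\int_{\mathbb R^d}\log\frac{\mathrm d\mu}{\mathrm d\pi}\,\mathrm d\mu\in[0,\infty]$ is the relative entropy. -/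

import Mathlib

open MeasureTheory Filter Topology
open scoped ENNReal

/-- `P2 d`: the Borel probability measures on `ℝ^d` with finite second moment. -/
@[ext]
structure P2 (d : ℕ) where
  /-- the underlying measure -/
  toMeasure : Measure (EuclideanSpace ℝ (Fin d))
  isProbabilityMeasure : IsProbabilityMeasure toMeasure
  secondMoment_lt_top : ∫⁻ x, ‖x‖ₑ ^ 2 ∂toMeasure < ∞

namespace P2

variable {d : ℕ}

instance (μ : P2 d) : IsProbabilityMeasure μ.toMeasure := μ.isProbabilityMeasure

/-- The couplings of `μ` and `ν`: measures on `ℝ^d × ℝ^d` with marginals `μ` and `ν`. Such a measure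
is automatically a probability measure with finite second moment. -/
def couplings (μ ν : P2 d) :
    Set (Measure (EuclideanSpace ℝ (Fin d) × EuclideanSpace ℝ (Fin d))) :=
  {γ | γ.map Prod.fst = μ.toMeasure ∧ γ.map Prod.snd = ν.toMeasure}

/-- The 2-Wasserstein distance
`W₂(μ, ν) = (inf over couplings γ of ∫ |x - y|² dγ)^(1/2)`, as an element of `[0, ∞]`. -/
noncomputable def W2 (μ ν : P2 d) : ℝ≥0∞ :=
  (⨅ γ ∈ couplings μ ν, ∫⁻ p, edist p.1 p.2 ^ 2 ∂γ) ^ (1 / 2 : ℝ)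

/-- The topology of the Wasserstein space: a set is open when it contains, with each of its points,
a `W₂`-ball around that point. -/
instance : TopologicalSpace (P2 d) where
  IsOpen s := ∀ μ ∈ s, ∃ ε : ℝ≥0∞, 0 < ε ∧ ∀ ν, W2 μ ν < ε → ν ∈ s
  isOpen_univ := fun _ _ => ⟨1, one_pos, fun _ _ => trivial⟩
  isOpen_inter := by
    rintro s t hs ht μ ⟨hμs, hμt⟩
    obtain ⟨ε, hε, h⟩ := hs μ hμs
    obtain ⟨δ, hδ, h'⟩ := ht μ hμt
    exact ⟨min ε δ, lt_min hε hδ, fun ν hν =>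
      ⟨h ν (hν.trans_le (min_le_left _ _)), h' ν (hν.trans_le (min_le_right _ _))⟩⟩
  isOpen_sUnion := by
    rintro S hS μ ⟨s, hsS, hμs⟩
    obtain ⟨ε, hε, h⟩ := hS s hsS μ hμs
    exact ⟨ε, hε, fun ν hν => ⟨s, hsS, h ν hν⟩⟩

/-- The mixture `μ + t (ν - μ) = (1 - t) μ + t ν` for `t ∈ [0, 1]`. -/
noncomputable def mix (μ ν : P2 d) (t : unitInterval) : P2 d where
  toMeasure := ENNReal.ofReal (1 - t) • μ.toMeasure + ENNReal.ofReal t • ν.toMeasure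
  isProbabilityMeasure := ⟨by
    simp only [Measure.coe_add, Measure.coe_smul, Pi.add_apply, Pi.smul_apply, measure_univ,
      smul_eq_mul, mul_one]
    rw [← ENNReal.ofReal_add (sub_nonneg.2 t.2.2) t.2.1]
    simp⟩
  secondMoment_lt_top := by
    rw [lintegral_add_measure, lintegral_smul_measure, lintegral_smul_measure]
    exact ENNReal.add_lt_top.2
      ⟨ENNReal.mul_lt_top ENNReal.ofReal_lt_top μ.secondMoment_lt_top,
        ENNReal.mul_lt_top ENNReal.ofReal_lt_top ν.secondMoment_lt_top⟩

/-- `D` is the flat derivative `δF/δμ` of `F : P2 d → ℝ`. The function `F` is of class `𝒞¹` when it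
has a flat derivative, which is then unique (take `ν` a Dirac mass in `hasDeriv`). -/
structure IsFlatDerivative (F : P2 d → ℝ) (D : P2 d → EuclideanSpace ℝ (Fin d) → ℝ) : Prop where
  continuous : Continuous (fun p : P2 d × EuclideanSpace ℝ (Fin d) => D p.1 p.2)
  growth : ∃ κ : ℝ, 0 < κ ∧ ∀ μ x, |D μ x| ≤ κ * (1 + ‖x‖ ^ 2)
  hasDeriv : ∀ μ ν : P2 d,
    Tendsto (fun t : unitInterval => (F (mix μ ν t) - F μ) / (t : ℝ)) (𝓝[>] 0)
      (𝓝 (∫ x, D μ x ∂ν.toMeasure - ∫ x, D μ x ∂μ.toMeasure))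
  normalized : ∀ μ : P2 d, ∫ x, D μ x ∂μ.toMeasure = 0

/-- The measures in `P2 d` that are absolutely continuous with respect to `π`. -/
def absCont (π : P2 d) : Set (P2 d) := {μ | μ.toMeasure ≪ π.toMeasure}

/-- The prox-linear objective
`∫ g d(μ - μ₀) + σ KL(μ|π) + (1/(2τ)) W₂²(μ, μ₀)` with values in `(-∞, +∞]`. -/
noncomputable def proxLinear (g : EuclideanSpace ℝ (Fin d) → ℝ) (σ τ : ℝ) (π μ₀ μ : P2 d) : EReal :=
  ((∫ x, g x ∂μ.toMeasure - ∫ x, g x ∂μ₀.toMeasure : ℝ) : EReal)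
    + ((ENNReal.ofReal σ * InformationTheory.klDiv μ.toMeasure π.toMeasure : ℝ≥0∞) : EReal)
    + ((ENNReal.ofReal (1 / (2 * τ)) * W2 μ μ₀ ^ 2 : ℝ≥0∞) : EReal)

end P2

/-! Every competitor has a density f with respect to π. Since g, the flat derivative at μ⁰, is
bounded and f has mass one, adding the bound C to g shifts the objective by a real constant and
makes all three terms nonnegative. What remains is a `densityFunctional` on probability densities
with values in [0, ∞].

The potential term is linear in f and the transport term convex, because couplings can be averaged.
The entropy is strongly midpoint convex, with a gain equal to a multiple of the squared Hellinger
distance (`klFun_midpoint_le`). This gain gives uniqueness. It also makes suitable minimizing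
sequences Cauchy in the Hellinger distance, that is, their square roots are Cauchy in L².
Completeness of L² then yields a limit density and a.e. convergence along a subsequence, so no
tightness or weak compactness is needed.

Along that subsequence Fatou's lemma handles the potential and the entropy. The transport cost is
lower semicontinuous by explicit surgery on plans (`transportCost_withDensity_le`): the mass common
to both densities keeps its plan, and the small remainder is coupled independently at a cost
controlled by second moments. -/

open InformationTheory

/-- Strong midpoint convexity of `t ↦ t log t + 1 - t`, measured by square roots. -/
theorem klFun_midpoint_le {a b : ℝ} (ha : 0 ≤ a) (hb : 0 ≤ b) :
    klFun ((a + b) / 2) + (√a - √b) ^ 2 / 4 ≤ (klFun a + klFun b) / 2 := by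
  set m := (a + b) / 2 with hm
  have hm0 : 0 ≤ m := by positivity
  -- This is log x ≤ x - 1 at x = √m / √t, multiplied by 2t. The bound t ≤ 2m serves only to give m
  -- > 0 when t > 0.
  have key : ∀ t, 0 ≤ t → t ≤ 2 * m → 2 * t - 2 * √t * √m ≤ t * Real.log t - t * Real.log m := by
    intro t ht htm
    rcases ht.eq_or_lt with rfl | ht
    · simp
    have hm : 0 < m := by linarith
    have h := Real.log_le_sub_one_of_pos (x := √m / √t) (by positivity)
    rw [Real.log_div (by positivity) (by positivity), Real.log_sqrt hm.le, Real.log_sqrt ht.le] at h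
    have h2 := mul_le_mul_of_nonneg_left h ht.le
    have h3 : t * (√m / √t) = √t * √m := by
      nth_rewrite 1 [← Real.mul_self_sqrt ht.le]
      field_simp
    rw [mul_sub t (√m / √t), h3] at h2
    linarith
  have h1 := key a ha (by linarith)
  have h2 := key b hb (by linarith)
  have h3 : a * Real.log m + b * Real.log m = 2 * (m * Real.log m) := by rw [hm]; ring
  simp only [klFun_apply]
  -- With s = (√a + √b) / 2, one has (√a - √b)² / 4 = m - s², and the claim reduces to (√m - s)² ≥
  -- 0.
  nlinarith [Real.sq_sqrt ha, Real.sq_sqrt hb, Real.sq_sqrt hm0, sq_nonneg (√m - (√a + √b) / 2)]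

/-! ### Entropy and Hellinger distance of densities -/

section Densities

variable {α : Type*} [MeasurableSpace α] {π : Measure α}

/-- The relative entropy of `π.withDensity f` with respect to `π`. -/
noncomputable def densityEntropy (π : Measure α) (f : α → ℝ≥0∞) : ℝ≥0∞ :=
  ∫⁻ x, ENNReal.ofReal (klFun (f x).toReal) ∂π

/-- The squared Hellinger distance between densities, up to normalization. -/
noncomputable def hellingerSq (π : Measure α) (f g : α → ℝ≥0∞) : ℝ≥0∞ :=
  ∫⁻ x, ENNReal.ofReal ((√(f x).toReal - √(g x).toReal) ^ 2) ∂π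

theorem klDiv_withDensity [IsFiniteMeasure π] {f : α → ℝ≥0∞} (hf : Measurable f)
    (hfi : ∫⁻ x, f x ∂π ≠ ∞) : klDiv (π.withDensity f) π = densityEntropy π f := by
  have := isFiniteMeasure_withDensity hfi
  rw [klDiv_eq_lintegral_klFun_of_ac (withDensity_absolutelyContinuous π f)]
  refine lintegral_congr_ae ?_
  filter_upwards [Measure.rnDeriv_withDensity π hf] with x hx
  rw [hx]

theorem densityEntropy_midpoint_le {f g : α → ℝ≥0∞} (hf : Measurable f) (hg : Measurable g)
    (hf' : ∀ᵐ x ∂π, f x ≠ ∞) (hg' : ∀ᵐ x ∂π, g x ≠ ∞) :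
    densityEntropy π (fun x => 2⁻¹ * (f x + g x)) + 4⁻¹ * hellingerSq π f g
      ≤ 2⁻¹ * (densityEntropy π f + densityEntropy π g) := by
  unfold densityEntropy hellingerSq
  rw [← lintegral_const_mul _ (by fun_prop), ← lintegral_add_right _ (by fun_prop),
    ← lintegral_add_right _ (by fun_prop), ← lintegral_const_mul _ (by fun_prop)]
  refine lintegral_mono_ae ?_
  filter_upwards [hf', hg'] with x hfx hgx
  have h := klFun_midpoint_le (f x).toReal_nonneg (g x).toReal_nonneg
  rw [ENNReal.toReal_mul, ENNReal.toReal_add hfx hgx]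
  have e4 : (4⁻¹ : ℝ≥0∞) = ENNReal.ofReal 4⁻¹ := by
    rw [ENNReal.ofReal_inv_of_pos (by norm_num)]; norm_num
  have e2 : (2⁻¹ : ℝ≥0∞) = ENNReal.ofReal 2⁻¹ := by
    rw [ENNReal.ofReal_inv_of_pos (by norm_num)]; norm_num
  have p1 := klFun_nonneg (f x).toReal_nonneg
  have p2 := klFun_nonneg (g x).toReal_nonneg
  rw [e4, e2, ← ENNReal.ofReal_mul (by norm_num), ← ENNReal.ofReal_add p1 p2,
    ← ENNReal.ofReal_mul (by norm_num), ← ENNReal.ofReal_add _ (by positivity)]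
  · refine ENNReal.ofReal_le_ofReal ?_
    rw [ENNReal.toReal_ofReal (by norm_num)]
    convert h using 1 <;> [skip; ring]
    congr 1
    · congr 1; ring
    · ring
  · exact klFun_nonneg (by positivity)

theorem ae_eq_of_hellingerSq_eq_zero {f g : α → ℝ≥0∞} (hf : Measurable f) (hg : Measurable g)
    (hf' : ∀ᵐ x ∂π, f x ≠ ∞) (hg' : ∀ᵐ x ∂π, g x ≠ ∞) (h : hellingerSq π f g = 0) :
    f =ᵐ[π] g := by
  unfold hellingerSq at h
  rw [lintegral_eq_zero_iff (by fun_prop)] at h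
  filter_upwards [h, hf', hg'] with x hx hfx hgx
  simp only [Pi.zero_apply, ENNReal.ofReal_eq_zero] at hx
  have h0 := pow_eq_zero_iff two_ne_zero |>.1 (le_antisymm hx (sq_nonneg _))
  rw [sub_eq_zero, Real.sqrt_inj ENNReal.toReal_nonneg ENNReal.toReal_nonneg] at h0
  exact (ENNReal.toReal_eq_toReal_iff' hfx hgx).1 h0

theorem eLpNorm_two_pow_two_eq_lintegral (u : α → ℝ) :
    eLpNorm u 2 π ^ 2 = ∫⁻ x, ENNReal.ofReal (u x ^ 2) ∂π := by
  have := eLpNorm_nnreal_pow_eq_lintegral (f := u) (μ := π) (p := 2) two_ne_zero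
  simp only [ENNReal.coe_ofNat, NNReal.coe_ofNat, ENNReal.rpow_ofNat] at this
  rw [this]
  refine lintegral_congr fun x => ?_
  rw [← sq_abs, ENNReal.ofReal_pow (abs_nonneg _), ← Real.enorm_eq_ofReal_abs]

/-- A sequence of probability densities that is summably Cauchy in the Hellinger distance has a
subsequence converging almost everywhere to a probability density. -/
theorem exists_subseq_tendsto_of_hellingerSq_lt {f : ℕ → α → ℝ≥0∞} (hf : ∀ n, Measurable (f n))
    (hf1 : ∀ n, ∫⁻ x, f n x ∂π = 1)
    (hc : ∀ N n m, N ≤ n → N ≤ m → hellingerSq π (f n) (f m) < (2⁻¹ ^ N) ^ 2) :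
    ∃ (g : α → ℝ≥0∞) (φ : ℕ → ℕ), Measurable g ∧ (∀ x, g x ≠ ∞) ∧ ∫⁻ x, g x ∂π = 1 ∧
      StrictMono φ ∧ ∀ᵐ x ∂π, Tendsto (fun n => f (φ n) x) atTop (𝓝 (g x)) := by
  -- Square roots of probability densities are unit vectors of L², and `hellingerSq` is the squared
  -- L² distance between them.
  set u : ℕ → α → ℝ := fun n x => √(f n x).toReal with hu
  have hum : ∀ n, Measurable (u n) := fun n => by fun_prop
  have hfin : ∀ n, ∀ᵐ x ∂π, f n x ≠ ∞ := fun n =>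
    (ae_lt_top (hf n) (by simp [hf1])).mono fun x hx => hx.ne
  have hfu : ∀ n, ∀ᵐ x ∂π, ENNReal.ofReal (u n x ^ 2) = f n x := fun n => by
    filter_upwards [hfin n] with x hx
    rw [hu, Real.sq_sqrt ENNReal.toReal_nonneg, ENNReal.ofReal_toReal hx]
  have hnorm : ∀ n, eLpNorm (u n) 2 π = 1 := fun n => by
    rw [← (ENNReal.pow_right_strictMono two_ne_zero).injective.eq_iff, eLpNorm_two_pow_two_eq_lintegral,
      lintegral_congr_ae (hfu n), hf1, one_pow]
  have hmem : ∀ n, MemLp (u n) 2 π := fun n =>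
    ⟨(hum n).aestronglyMeasurable, by simp [hnorm]⟩
  obtain ⟨v, hv, hlim⟩ := Lp.cauchy_complete_eLpNorm (p := 2) one_le_two hmem
    (B := fun n => 2⁻¹ ^ n) (by rw [ENNReal.tsum_geometric]; simp) (fun N n m hn hm => by
      refine lt_of_pow_lt_pow_left' 2 ?_
      rw [eLpNorm_two_pow_two_eq_lintegral]
      exact hc N n m hn hm)
  obtain ⟨φ, hφ, hae⟩ := (tendstoInMeasure_of_tendsto_eLpNorm two_ne_zero
    (fun n => (hmem n).1) hv.1 hlim).exists_seq_tendsto_ae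
  -- Strong L² convergence preserves the norm, so no mass is lost in the limit density v².
  have hvn : eLpNorm v 2 π = 1 := by
    refine le_antisymm ?_ ?_
    · have h : ∀ n, eLpNorm v 2 π ≤ 1 + eLpNorm (u n - v) 2 π := fun n => by
        have := eLpNorm_sub_le (p := 2) (hmem n).1 ((hmem n).sub hv).1 one_le_two
        simpa [hnorm] using this
      simpa using ge_of_tendsto' (hlim.const_add 1) h
    · have h : ∀ n, 1 ≤ eLpNorm v 2 π + eLpNorm (u n - v) 2 π := fun n => by
        have := eLpNorm_add_le (p := 2) hv.1 ((hmem n).sub hv).1 one_le_two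
        simpa [hnorm] using this
      simpa using ge_of_tendsto' (hlim.const_add (eLpNorm v 2 π)) h
  have hvmk := hv.1.ae_eq_mk
  refine ⟨fun x => ENNReal.ofReal (hv.1.mk v x ^ 2), φ,
    (hv.1.stronglyMeasurable_mk.measurable.pow_const 2).ennreal_ofReal,
    fun x => ENNReal.ofReal_ne_top, ?_, hφ, ?_⟩
  · rw [← eLpNorm_two_pow_two_eq_lintegral, ← eLpNorm_congr_ae hvmk, hvn, one_pow]
  · filter_upwards [hae, hvmk, ae_all_iff.2 hfu] with x hx hxmk hxf
    rw [← hxmk]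
    simp only [← hxf]
    exact ENNReal.tendsto_ofReal (hx.pow 2)

end Densities

/-! ### Quadratic transport cost and its convexity -/

section Transport

variable {E : Type*} [PseudoEMetricSpace E] [MeasurableSpace E]

/-- The optimal quadratic transport cost between two measures. -/
noncomputable def transportCost (μ ν : Measure E) : ℝ≥0∞ :=
  ⨅ γ ∈ {γ : Measure (E × E) | γ.map Prod.fst = μ ∧ γ.map Prod.snd = ν},
    ∫⁻ p, edist p.1 p.2 ^ 2 ∂γ

theorem transportCost_le {μ ν : Measure E} {γ : Measure (E × E)} (h₁ : γ.map Prod.fst = μ)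
    (h₂ : γ.map Prod.snd = ν) : transportCost μ ν ≤ ∫⁻ p, edist p.1 p.2 ^ 2 ∂γ :=
  iInf₂_le γ ⟨h₁, h₂⟩

theorem exists_coupling_of_transportCost_lt {μ ν : Measure E} {a : ℝ≥0∞}
    (h : transportCost μ ν < a) : ∃ γ : Measure (E × E), γ.map Prod.fst = μ ∧
      γ.map Prod.snd = ν ∧ ∫⁻ p, edist p.1 p.2 ^ 2 ∂γ < a := by
  obtain ⟨γ, hγ⟩ := iInf_lt_iff.1 h
  obtain ⟨⟨h₁, h₂⟩, h₃⟩ := iInf_lt_iff.1 hγ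
  exact ⟨γ, h₁, h₂, h₃⟩

/-- The average of two couplings couples the averaged marginals, and the cost is linear in the
coupling. Near-optimal plans suffice, so existence of optimal ones is not needed. -/
theorem transportCost_midpoint_le (μ μ' ν : Measure E) :
    transportCost ((2⁻¹ : ℝ≥0∞) • (μ + μ')) ν
      ≤ 2⁻¹ * (transportCost μ ν + transportCost μ' ν) := by
  rcases eq_or_ne (transportCost μ ν) ∞ with h | h
  · simp [h, ENNReal.mul_top]
  rcases eq_or_ne (transportCost μ' ν) ∞ with h' | h'
  · simp [h', ENNReal.mul_top]
  refine ENNReal.le_of_forall_pos_le_add fun ε hε _ => ?_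
  have hε' : (ε : ℝ≥0∞) ≠ 0 := by simpa using hε.ne'
  obtain ⟨γ, h₁, h₂, h₃⟩ := exists_coupling_of_transportCost_lt (ENNReal.lt_add_right h hε')
  obtain ⟨γ', h₁', h₂', h₃'⟩ := exists_coupling_of_transportCost_lt (ENNReal.lt_add_right h' hε')
  refine (transportCost_le (γ := (2⁻¹ : ℝ≥0∞) • (γ + γ')) ?_ ?_).trans ?_
  · rw [Measure.map_smul, Measure.map_add _ _ measurable_fst, h₁, h₁']
  · rw [Measure.map_smul, Measure.map_add _ _ measurable_snd, h₂, h₂', ← two_smul ℝ≥0∞, smul_smul,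
      ENNReal.inv_mul_cancel two_ne_zero ENNReal.ofNat_ne_top, one_smul]
  · rw [lintegral_smul_measure, lintegral_add_measure, smul_eq_mul]
    calc 2⁻¹ * (∫⁻ p, edist p.1 p.2 ^ 2 ∂γ + ∫⁻ p, edist p.1 p.2 ^ 2 ∂γ')
        ≤ 2⁻¹ * ((transportCost μ ν + ε) + (transportCost μ' ν + ε)) := by gcongr
      _ = 2⁻¹ * (transportCost μ ν + transportCost μ' ν) + 2⁻¹ * (2 * ε) := by ring
      _ = _ := by
        rw [← mul_assoc, ENNReal.inv_mul_cancel two_ne_zero ENNReal.ofNat_ne_top, one_mul]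

end Transport

theorem map_withDensity_comp_fst {α β : Type*} [MeasurableSpace α]
    [MeasurableSpace β] {γ : Measure (α × β)} {w : α → ℝ≥0∞} (hw : Measurable w) :
    (γ.withDensity fun p => w p.1).map Prod.fst = (γ.map Prod.fst).withDensity w := by
  ext s hs
  rw [Measure.map_apply measurable_fst hs, withDensity_apply _ (measurable_fst hs),
    withDensity_apply _ hs, setLIntegral_map hs hw measurable_fst]

/-! ### Second moments and lower semicontinuity of the transport cost -/

section Moments

theorem edist_sq_le {E : Type*} [SeminormedAddCommGroup E] (x y : E) : edist x y ^ 2 ≤ 2 * ‖x‖ₑ ^ 2 + 2 * ‖y‖ₑ ^ 2 := by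
  rw [edist_eq_enorm_sub]
  calc ‖x - y‖ₑ ^ 2 ≤ (‖x‖ₑ + ‖y‖ₑ) ^ 2 := by gcongr; exact enorm_sub_le
    _ ≤ _ := by
      simp only [enorm_eq_nnnorm]
      rw [← mul_add]
      exact_mod_cast add_sq_le (a := ‖x‖₊) (b := ‖y‖₊)

theorem enorm_sq_le {E : Type*} [SeminormedAddCommGroup E] (x y : E) : ‖x‖ₑ ^ 2 ≤ 2 * edist x y ^ 2 + 2 * ‖y‖ₑ ^ 2 := by
  have h := edist_sq_le (x - y) (-y)
  simpa [edist_eq_enorm_sub] using h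

variable {E : Type*} [NormedAddCommGroup E] [MeasurableSpace E] [BorelSpace E]
  [SecondCountableTopology E]

/-- Measures of equal finite mass have a coupling of cost at most twice the sum of the second
moments. -/
theorem exists_coupling_le {α β : Measure E} [IsFiniteMeasure α] [IsFiniteMeasure β]
    (h : α Set.univ = β Set.univ) : ∃ γ : Measure (E × E), γ.map Prod.fst = α ∧
      γ.map Prod.snd = β ∧ ∫⁻ p, edist p.1 p.2 ^ 2 ∂γ
        ≤ 2 * ∫⁻ x, ‖x‖ₑ ^ 2 ∂α + 2 * ∫⁻ x, ‖x‖ₑ ^ 2 ∂β := by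
  rcases eq_or_ne (α Set.univ) 0 with h0 | h0
  · have hα := Measure.measure_univ_eq_zero.1 h0
    have hβ := Measure.measure_univ_eq_zero.1 (h ▸ h0)
    exact ⟨0, by simp [hα], by simp [hβ], by simp⟩
  have ht : α Set.univ ≠ ∞ := measure_ne_top _ _
  have h₁ : ((α Set.univ)⁻¹ • α.prod β).map Prod.fst = α := by
    rw [Measure.map_smul, Measure.map_fst_prod, ← h, smul_smul, ENNReal.inv_mul_cancel h0 ht,
      one_smul]
  have h₂ : ((α Set.univ)⁻¹ • α.prod β).map Prod.snd = β := by
    rw [Measure.map_smul, Measure.map_snd_prod, smul_smul, ENNReal.inv_mul_cancel h0 ht,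
      one_smul]
  refine ⟨_, h₁, h₂, ?_⟩
  set γ := (α Set.univ)⁻¹ • α.prod β
  calc ∫⁻ p, edist p.1 p.2 ^ 2 ∂γ ≤ ∫⁻ p, 2 * ‖p.1‖ₑ ^ 2 + 2 * ‖p.2‖ₑ ^ 2 ∂γ :=
        lintegral_mono fun p => edist_sq_le _ _
    _ = 2 * ∫⁻ x, ‖x‖ₑ ^ 2 ∂(γ.map Prod.fst) + 2 * ∫⁻ x, ‖x‖ₑ ^ 2 ∂(γ.map Prod.snd) := by
        rw [lintegral_map (by fun_prop) measurable_fst, lintegral_map (by fun_prop) measurable_snd,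
          lintegral_add_left (by fun_prop), lintegral_const_mul _ (by fun_prop),
          lintegral_const_mul _ (by fun_prop)]
    _ = _ := by rw [h₁, h₂]

/-- Integrate |x|² ≤ 2|x - y|² + 2|y|² against a near-optimal plan. This turns a bound on the cost
into a bound on the second moment. -/
theorem lintegral_enorm_sq_le_transportCost (μ ν : Measure E) :
    ∫⁻ x, ‖x‖ₑ ^ 2 ∂μ ≤ 2 * transportCost μ ν + 2 * ∫⁻ x, ‖x‖ₑ ^ 2 ∂ν := by
  rcases eq_or_ne (transportCost μ ν) ∞ with h | h
  · simp [h]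
  refine ENNReal.le_of_forall_pos_le_add fun ε hε _ => ?_
  have hε' : (ε : ℝ≥0∞) / 2 ≠ 0 := by simpa using hε.ne'
  obtain ⟨γ, h₁, h₂, h₃⟩ := exists_coupling_of_transportCost_lt (ENNReal.lt_add_right h hε')
  calc ∫⁻ x, ‖x‖ₑ ^ 2 ∂μ = ∫⁻ p, ‖p.1‖ₑ ^ 2 ∂γ := by
        rw [← h₁, lintegral_map (by fun_prop) measurable_fst]
    _ ≤ ∫⁻ p, 2 * edist p.1 p.2 ^ 2 + 2 * ‖p.2‖ₑ ^ 2 ∂γ :=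
        lintegral_mono fun p => enorm_sq_le _ _
    _ = 2 * ∫⁻ p, edist p.1 p.2 ^ 2 ∂γ + 2 * ∫⁻ x, ‖x‖ₑ ^ 2 ∂ν := by
        rw [← h₂, lintegral_map (by fun_prop) measurable_snd, lintegral_add_right _ (by fun_prop),
          lintegral_const_mul _ (by fun_prop), lintegral_const_mul _ (by fun_prop)]
    _ ≤ 2 * (transportCost μ ν + ε / 2) + 2 * ∫⁻ x, ‖x‖ₑ ^ 2 ∂ν := by gcongr
    _ = _ := by
        rw [mul_add, ENNReal.mul_div_cancel two_ne_zero ENNReal.ofNat_ne_top]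
        ring

/-- The largest second moment of a submeasure of `ν` of mass at most `m`. -/
noncomputable def submeasureMoment (ν : Measure E) (m : ℝ≥0∞) : ℝ≥0∞ :=
  ⨆ β ∈ {β : Measure E | β ≤ ν ∧ β Set.univ ≤ m}, ∫⁻ x, ‖x‖ₑ ^ 2 ∂β

/-- Absolute continuity of the integral of |x|², uniformly over submeasures: where |x|² ≥ n the tail
of ν is small, and elsewhere the moment is at most n times the mass. -/
theorem tendsto_submeasureMoment {ν : Measure E} (hν : ∫⁻ x, ‖x‖ₑ ^ 2 ∂ν ≠ ∞) :
    Tendsto (submeasureMoment ν) (𝓝 0) (𝓝 0) := by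
  have htail : Tendsto (fun n : ℕ => ∫⁻ x in {x | (n : ℝ≥0∞) ≤ ‖x‖ₑ ^ 2}, ‖x‖ₑ ^ 2 ∂ν)
      atTop (𝓝 0) := by
    refine tendsto_setLIntegral_zero hν ?_
    have hb : Tendsto (fun n : ℕ => (∫⁻ x, ‖x‖ₑ ^ 2 ∂ν) / n) atTop (𝓝 0) := by
      simpa using ENNReal.Tendsto.const_div ENNReal.tendsto_nat_nhds_top (Or.inr hν)
    refine tendsto_of_tendsto_of_tendsto_of_le_of_le' tendsto_const_nhds hb
      (Eventually.of_forall fun _ => zero_le) ?_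
    filter_upwards [eventually_gt_atTop 0] with n hn
    exact meas_ge_le_lintegral_div (by fun_prop) (by simpa using hn.ne') (ENNReal.natCast_ne_top n)
  refine ENNReal.tendsto_nhds_zero.2 fun ε hε => ?_
  have hε2 : 0 < ε / 2 := ENNReal.half_pos hε.ne'
  obtain ⟨n, hn⟩ := (ENNReal.tendsto_nhds_zero.1 htail _ hε2).exists
  have hm : Tendsto (fun m : ℝ≥0∞ => n * m) (𝓝 0) (𝓝 0) := by
    simpa using ENNReal.Tendsto.const_mul (a := (n : ℝ≥0∞)) (b := 0) tendsto_id
      (Or.inr (ENNReal.natCast_ne_top n))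
  filter_upwards [ENNReal.tendsto_nhds_zero.1 hm _ hε2] with m hm
  refine iSup₂_le fun β hβ => ?_
  set s := {x : E | (n : ℝ≥0∞) ≤ ‖x‖ₑ ^ 2}
  have hs : MeasurableSet s := measurableSet_le measurable_const (by fun_prop)
  calc ∫⁻ x, ‖x‖ₑ ^ 2 ∂β = ∫⁻ x in s, ‖x‖ₑ ^ 2 ∂β + ∫⁻ x in sᶜ, ‖x‖ₑ ^ 2 ∂β :=
        (lintegral_add_compl _ hs).symm
    _ ≤ ∫⁻ x in s, ‖x‖ₑ ^ 2 ∂ν + ∫⁻ _ in sᶜ, n ∂β := by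
        refine add_le_add (lintegral_mono' (Measure.restrict_mono le_rfl hβ.1) le_rfl)
          (setLIntegral_mono measurable_const fun x hx => ?_)
        exact (not_le.1 (show ¬ (n : ℝ≥0∞) ≤ ‖x‖ₑ ^ 2 from hx)).le
    _ ≤ ε / 2 + n * m := by
        refine add_le_add hn ?_
        rw [setLIntegral_const]
        gcongr
        exact (measure_mono (Set.subset_univ _)).trans hβ.2
    _ ≤ ε / 2 + ε / 2 := by gcongr
    _ = ε := ENNReal.add_halves ε

/-- Replacing a density by another one changes the transport cost by at most the second moments of
the mass that has to be moved: the common part keeps its transport plan, the rest is coupled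
independently. -/
theorem transportCost_withDensity_le {π ν : Measure E} [IsFiniteMeasure π] [IsFiniteMeasure ν]
    {f f' : E → ℝ≥0∞} (hf : Measurable f) (hf' : Measurable f')
    (hfi : ∫⁻ x, f x ∂π ≠ ∞) (hf't : ∀ᵐ x ∂π, f' x ≠ ∞)
    (hff' : ∫⁻ x, f x ∂π = ∫⁻ x, f' x ∂π) :
    transportCost (π.withDensity f) ν ≤ transportCost (π.withDensity f') ν
      + (2 * ∫⁻ x, ‖x‖ₑ ^ 2 * (f x - f' x) ∂π
        + 2 * submeasureMoment ν (∫⁻ x, f x - f' x ∂π)) := by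
  rcases eq_or_ne (transportCost (π.withDensity f') ν) ∞ with h | h
  · simp [h]
  refine ENNReal.le_of_forall_pos_le_add fun ε hε _ => ?_
  have hε' : (ε : ℝ≥0∞) ≠ 0 := by simpa using hε.ne'
  obtain ⟨γ, h₁, h₂, h₃⟩ := exists_coupling_of_transportCost_lt (ENNReal.lt_add_right h hε')
  -- The fraction of the mass of f' at x that f can reuse. Weighting γ by it keeps exactly the part
  -- of the plan that starts from min(f, f'). Where f' = 0 the numerator vanishes as well, so the
  -- quotient is 0.
  set w : E → ℝ≥0∞ := fun x => min (f x) (f' x) / f' x with hw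
  have hwm : Measurable w := (hf.min hf').div hf'
  have hw1 : ∀ x, w x ≤ 1 := fun x => ENNReal.div_le_of_le_mul (by simp)
  set γ₁ := γ.withDensity (fun p => w p.1) with hγ₁
  have hγ₁γ : γ₁ ≤ γ := by
    calc γ₁ ≤ γ.withDensity 1 := withDensity_mono (Eventually.of_forall fun p => hw1 p.1)
      _ = γ := withDensity_one
  have hfst : γ₁.map Prod.fst = π.withDensity (fun x => min (f x) (f' x)) := by
    rw [map_withDensity_comp_fst hwm, h₁, ← withDensity_mul _ hf' hwm]
    refine withDensity_congr_ae ?_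
    filter_upwards [hf't] with x hx
    rw [Pi.mul_apply, hw]
    rcases eq_or_ne (f' x) 0 with h0 | h0
    · simp [h0]
    · exact ENNReal.mul_div_cancel h0 hx
  have hsnd : γ₁.map Prod.snd ≤ ν := h₂ ▸ Measure.map_mono hγ₁γ measurable_snd
  have : IsFiniteMeasure (γ₁.map Prod.snd) := isFiniteMeasure_of_le ν hsnd
  have hsub : ∫⁻ x, f x - f' x ∂π ≤ ∫⁻ x, f x ∂π := lintegral_mono fun x => tsub_le_self
  have : IsFiniteMeasure (π.withDensity fun x => f x - f' x) :=
    isFiniteMeasure_withDensity (ne_top_of_le_ne_top hfi hsub)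
  have hβ := Measure.sub_add_cancel_of_le hsnd
  have hmin : ∫⁻ x, min (f x) (f' x) ∂π = γ₁.map Prod.snd Set.univ := by
    have := congrArg (fun m : Measure E => m Set.univ) hfst
    simp only [withDensity_apply _ MeasurableSet.univ, Measure.restrict_univ] at this
    rw [← this, Measure.map_apply measurable_fst MeasurableSet.univ,
      Measure.map_apply measurable_snd MeasurableSet.univ, Set.preimage_univ, Set.preimage_univ]
  have hmass : (π.withDensity fun x => f x - f' x) Set.univ
      = (ν - γ₁.map Prod.snd) Set.univ := by
    -- The two leftovers are compared after adding back the finite mass already transported, using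
    -- (f - f') + min(f, f') = f for truncated subtraction.
    refine (ENNReal.add_left_inj (measure_ne_top (γ₁.map Prod.snd) Set.univ)).1 ?_
    rw [← Measure.add_apply (ν - _), hβ, ← hmin, withDensity_apply _ MeasurableSet.univ,
      Measure.restrict_univ, ← lintegral_add_right _ (hf.min hf')]
    simp only [tsub_add_min]
    have := congrArg (fun m : Measure E => m Set.univ) h₁
    simp only [withDensity_apply _ MeasurableSet.univ, Measure.restrict_univ] at this
    rw [hff', ← this, ← h₂, Measure.map_apply measurable_fst MeasurableSet.univ,
      Measure.map_apply measurable_snd MeasurableSet.univ, Set.preimage_univ, Set.preimage_univ]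
  obtain ⟨γ₂, h₁', h₂', h₃'⟩ := exists_coupling_le hmass
  have hmass' : (ν - γ₁.map Prod.snd) Set.univ ≤ ∫⁻ x, f x - f' x ∂π := by
    rw [← hmass, withDensity_apply _ MeasurableSet.univ, Measure.restrict_univ]
  have hmom : ∫⁻ x, ‖x‖ₑ ^ 2 ∂(ν - γ₁.map Prod.snd)
      ≤ submeasureMoment ν (∫⁻ x, f x - f' x ∂π) :=
    le_iSup₂_of_le (ν - γ₁.map Prod.snd) ⟨Measure.sub_le, hmass'⟩ le_rfl
  have hmomα : ∫⁻ x, ‖x‖ₑ ^ 2 ∂(π.withDensity fun x => f x - f' x)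
      = ∫⁻ x, ‖x‖ₑ ^ 2 * (f x - f' x) ∂π := by
    rw [lintegral_withDensity_eq_lintegral_mul (g := fun x => ‖x‖ₑ ^ 2) _
      (show Measurable fun x => f x - f' x from hf.sub hf') (by fun_prop)]
    exact lintegral_congr fun x => mul_comm _ _
  calc transportCost (π.withDensity f) ν
      ≤ ∫⁻ p, edist p.1 p.2 ^ 2 ∂(γ₁ + γ₂) := by
        refine transportCost_le ?_ ?_
        · rw [Measure.map_add _ _ measurable_fst, hfst, h₁', add_comm,
            
            ← withDensity_add_left (show Measurable fun x => f x - f' x from hf.sub hf')]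
          congr 1
          funext x
          exact tsub_add_min
        · rw [Measure.map_add _ _ measurable_snd, h₂', add_comm, hβ]
    _ = ∫⁻ p, edist p.1 p.2 ^ 2 ∂γ₁ + ∫⁻ p, edist p.1 p.2 ^ 2 ∂γ₂ := lintegral_add_measure _ _ _
    _ ≤ (transportCost (π.withDensity f') ν + ε) + (2 * ∫⁻ x, ‖x‖ₑ ^ 2 * (f x - f' x) ∂π
        + 2 * submeasureMoment ν (∫⁻ x, f x - f' x ∂π)) := by
        refine add_le_add ((lintegral_mono' hγ₁γ le_rfl).trans h₃.le) (h₃'.trans ?_)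
        rw [hmomα]
        gcongr
    _ = _ := by ring

/-- The transport cost is lower semicontinuous along almost everywhere convergence of densities
of equal mass. -/
theorem transportCost_withDensity_le_liminf {π ν : Measure E} [IsFiniteMeasure π]
    [IsFiniteMeasure ν] {f : E → ℝ≥0∞} {fs : ℕ → E → ℝ≥0∞} (hf : Measurable f)
    (hfs : ∀ n, Measurable (fs n)) (hft : ∀ x, f x ≠ ∞) (hfi : ∫⁻ x, f x ∂π ≠ ∞)
    (hmass : ∀ n, ∫⁻ x, f x ∂π = ∫⁻ x, fs n x ∂π)
    (hlim : ∀ᵐ x ∂π, Tendsto (fun n => fs n x) atTop (𝓝 (f x)))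
    (hmom : ∫⁻ x, ‖x‖ₑ ^ 2 * f x ∂π ≠ ∞) (hν : ∫⁻ x, ‖x‖ₑ ^ 2 ∂ν ≠ ∞) :
    transportCost (π.withDensity f) ν
      ≤ liminf (fun n => transportCost (π.withDensity (fs n)) ν) atTop := by
  -- The truncated difference is dominated by f itself, so dominated convergence needs only the
  -- integrability and second moment of the limit, with no uniform integrability of the sequence.
  have hsub : ∀ᵐ x ∂π, Tendsto (fun n => f x - fs n x) atTop (𝓝 0) := by
    filter_upwards [hlim] with x hx
    simpa using ENNReal.Tendsto.sub (tendsto_const_nhds (x := f x)) hx (Or.inl (hft x))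
  have h1 : Tendsto (fun n => ∫⁻ x, f x - fs n x ∂π) atTop (𝓝 0) := by
    simpa using tendsto_lintegral_of_dominated_convergence f (fun n => hf.sub (hfs n))
      (fun n => Eventually.of_forall fun x => tsub_le_self) hfi hsub
  have h2 : Tendsto (fun n => ∫⁻ x, ‖x‖ₑ ^ 2 * (f x - fs n x) ∂π) atTop (𝓝 0) := by
    have := tendsto_lintegral_of_dominated_convergence (μ := π)
      (F := fun n x => ‖x‖ₑ ^ 2 * (f x - fs n x)) (f := fun _ => 0) (fun x => ‖x‖ₑ ^ 2 * f x)
      (fun n => by fun_prop) (fun n => Eventually.of_forall fun x =>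
        mul_le_mul_right tsub_le_self _) hmom (by
        filter_upwards [hsub] with x hx
        simpa using ENNReal.Tendsto.const_mul (a := ‖x‖ₑ ^ 2) hx (Or.inr (by simp)))
    simpa using this
  have h3 := (ENNReal.Tendsto.const_mul (a := 2) h2 (Or.inr ENNReal.ofNat_ne_top)).add
    (ENNReal.Tendsto.const_mul (a := 2) ((tendsto_submeasureMoment hν).comp h1)
      (Or.inr ENNReal.ofNat_ne_top))
  simp only [mul_zero, add_zero] at h3
  rw [← ENNReal.liminf_add_of_right_tendsto_zero h3]
  refine le_liminf_of_le (by isBoundedDefault) ?_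
  refine Eventually.of_forall fun n => ?_
  exact transportCost_withDensity_le hf (hfs n) hfi
    ((ae_lt_top (hfs n) (hmass n ▸ hfi)).mono fun x hx => hx.ne) (hmass n)

end Moments

theorem liminf_add_liminf_le (u v : ℕ → ℝ≥0∞) :
    liminf u atTop + liminf v atTop ≤ liminf (fun n => u n + v n) atTop := by
  simp only [liminf_eq_iSup_iInf_of_nat']
  rw [ENNReal.iSup_add_iSup_of_monotone]
  · exact iSup_mono fun n => le_iInf fun i => add_le_add (iInf_le _ i) (iInf_le _ i)
  all_goals
    intro m n hmn
    refine le_iInf fun i => (iInf_le _ (i + (n - m))).trans_eq ?_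
    congr 1
    omega

/-! ### Strong convexity of the functional and uniqueness -/

section Variational

variable {E : Type*} [PseudoEMetricSpace E] [MeasurableSpace E] {π ν : Measure E} {g : E → ℝ≥0∞}
  {a b : ℝ≥0∞}

/-- The entropic transport functional of the density `f`: a potential energy plus a multiple of
the relative entropy plus a multiple of the transport cost to `ν`. -/
noncomputable def densityFunctional (π ν : Measure E) (g : E → ℝ≥0∞) (a b : ℝ≥0∞)
    (f : E → ℝ≥0∞) : ℝ≥0∞ :=
  ∫⁻ x, g x * f x ∂π + a * densityEntropy π f + b * transportCost (π.withDensity f) ν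

/-- The potential is affine at midpoints and the transport term convex. The whole Hellinger gain
comes from the entropy. -/
theorem densityFunctional_midpoint_le (hg : Measurable g) {f f' : E → ℝ≥0∞} (hf : Measurable f)
    (hf' : Measurable f') (hft : ∀ᵐ x ∂π, f x ≠ ∞) (hft' : ∀ᵐ x ∂π, f' x ≠ ∞) :
    densityFunctional π ν g a b (fun x => 2⁻¹ * (f x + f' x)) + a * 4⁻¹ * hellingerSq π f f'
      ≤ 2⁻¹ * (densityFunctional π ν g a b f + densityFunctional π ν g a b f') := by
  have h1 : ∫⁻ x, g x * (2⁻¹ * (f x + f' x)) ∂π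
      = 2⁻¹ * (∫⁻ x, g x * f x ∂π + ∫⁻ x, g x * f' x ∂π) := by
    rw [← lintegral_add_left (by fun_prop), ← lintegral_const_mul _ (by fun_prop)]
    exact lintegral_congr fun x => by ring
  have h2 := densityEntropy_midpoint_le hf hf' hft hft'
  have h3 : π.withDensity (fun x => 2⁻¹ * (f x + f' x))
      = (2⁻¹ : ℝ≥0∞) • (π.withDensity f + π.withDensity f') := by
    rw [← withDensity_add_left hf, ← withDensity_smul _ (hf.add hf')]
    rfl
  have h4 := transportCost_midpoint_le (π.withDensity f) (π.withDensity f') ν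
  unfold densityFunctional
  rw [h1, h3]
  calc _ = 2⁻¹ * (∫⁻ x, g x * f x ∂π + ∫⁻ x, g x * f' x ∂π)
        + a * (densityEntropy π (fun x => 2⁻¹ * (f x + f' x)) + 4⁻¹ * hellingerSq π f f')
        + b * transportCost ((2⁻¹ : ℝ≥0∞) • (π.withDensity f + π.withDensity f')) ν := by ring
    _ ≤ 2⁻¹ * (∫⁻ x, g x * f x ∂π + ∫⁻ x, g x * f' x ∂π)
        + a * (2⁻¹ * (densityEntropy π f + densityEntropy π f'))
        + b * (2⁻¹ * (transportCost (π.withDensity f) ν + transportCost (π.withDensity f') ν)) := by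
        gcongr
    _ = _ := by ring

theorem lintegral_midpoint_eq_one {α : Type*} [MeasurableSpace α] {π : Measure α}
    {f f' : α → ℝ≥0∞} (hf : Measurable f) (hf1 : ∫⁻ x, f x ∂π = 1) (hf1' : ∫⁻ x, f' x ∂π = 1) :
    ∫⁻ x, 2⁻¹ * (f x + f' x) ∂π = 1 := by
  rw [lintegral_const_mul' _ _ (by simp), lintegral_add_left hf, hf1, hf1', one_add_one_eq_two,
    ENNReal.inv_mul_cancel two_ne_zero ENNReal.ofNat_ne_top]

/-- Minimizers of the entropic transport functional are unique. -/
theorem ae_eq_of_densityFunctional_minimizers (hg : Measurable g) (ha : a ≠ 0)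
    {f f' : E → ℝ≥0∞} (hf : Measurable f) (hf' : Measurable f')
    (hft : ∀ᵐ x ∂π, f x ≠ ∞) (hft' : ∀ᵐ x ∂π, f' x ≠ ∞)
    (hfin : densityFunctional π ν g a b f ≠ ∞)
    (heq : densityFunctional π ν g a b f' = densityFunctional π ν g a b f)
    (hle : densityFunctional π ν g a b f
      ≤ densityFunctional π ν g a b fun x => 2⁻¹ * (f x + f' x)) : f =ᵐ[π] f' := by
  have hmid := densityFunctional_midpoint_le (ν := ν) (a := a) (b := b) hg hf hf' hft hft'
  rw [heq, ← two_mul, ← mul_assoc, ENNReal.inv_mul_cancel two_ne_zero ENNReal.ofNat_ne_top,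
    one_mul] at hmid
  -- Minimality of f against the midpoint gives Φ(f) + gain ≤ Φ(f), and finiteness of Φ(f) allows
  -- cancellation.
  have h0 : a * 4⁻¹ * hellingerSq π f f' = 0 := by
    have h := (add_le_add_left hle _).trans hmid
    nth_rewrite 2 [← add_zero (densityFunctional π ν g a b f)] at h
    exact le_antisymm ((ENNReal.add_le_add_iff_left hfin).1 h) zero_le
  rcases mul_eq_zero.1 h0 with h | h
  · rcases mul_eq_zero.1 h with h | h
    · exact absurd h ha
    · simp at h
  · exact ae_eq_of_hellingerSq_eq_zero hf hf' hft hft' h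

end Variational

/-! ### Lower semicontinuity and the direct method -/

section Existence

variable {E : Type*} [NormedAddCommGroup E] [MeasurableSpace E] [BorelSpace E]
  [SecondCountableTopology E] {π ν : Measure E} {g : E → ℝ≥0∞} {a b : ℝ≥0∞}

/-- Potential and entropy have nonnegative integrands, so Fatou's lemma applies. The transport term
needs a finite second moment of the limit: the bound M controls the costs, hence the moments along
the sequence, and Fatou passes this to f. -/
theorem densityFunctional_le_liminf [IsFiniteMeasure π] [IsFiniteMeasure ν] (hg : Measurable g)
    (hgt : ∀ x, g x ≠ ∞) (ha : a ≠ ∞) (hb : b ≠ 0) (hb' : b ≠ ∞) (hν : ∫⁻ x, ‖x‖ₑ ^ 2 ∂ν ≠ ∞) {f : E → ℝ≥0∞}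
    {fs : ℕ → E → ℝ≥0∞} (hf : Measurable f) (hfs : ∀ n, Measurable (fs n)) (hft : ∀ x, f x ≠ ∞)
    (hf1 : ∫⁻ x, f x ∂π = 1) (hfs1 : ∀ n, ∫⁻ x, fs n x ∂π = 1)
    (hlim : ∀ᵐ x ∂π, Tendsto (fun n => fs n x) atTop (𝓝 (f x))) {M : ℝ≥0∞} (hM : M ≠ ∞)
    (hbd : ∀ n, densityFunctional π ν g a b (fs n) ≤ M) :
    densityFunctional π ν g a b f
      ≤ liminf (fun n => densityFunctional π ν g a b (fs n)) atTop := by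
  have hT : ∀ n, transportCost (π.withDensity (fs n)) ν ≤ b⁻¹ * M := fun n => by
    rw [mul_comm, ← div_eq_mul_inv, ENNReal.le_div_iff_mul_le (Or.inl hb) (Or.inl hb'), mul_comm]
    exact le_add_self.trans (hbd n)
  have hmoms : ∀ n, ∫⁻ x, ‖x‖ₑ ^ 2 * fs n x ∂π ≤ 2 * (b⁻¹ * M) + 2 * ∫⁻ x, ‖x‖ₑ ^ 2 ∂ν := by
    intro n
    have h := lintegral_enorm_sq_le_transportCost (π.withDensity (fs n)) ν
    rw [lintegral_withDensity_eq_lintegral_mul (g := fun x => ‖x‖ₑ ^ 2) _ (hfs n)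
      (by fun_prop)] at h
    calc ∫⁻ x, ‖x‖ₑ ^ 2 * fs n x ∂π = ∫⁻ x, (fs n * fun x : E => ‖x‖ₑ ^ 2) x ∂π :=
          lintegral_congr fun x => mul_comm _ _
      _ ≤ _ := h.trans (by gcongr; exact hT n)
  have hmom : ∫⁻ x, ‖x‖ₑ ^ 2 * f x ∂π ≠ ∞ := by
    refine ne_top_of_le_ne_top (b := 2 * (b⁻¹ * M) + 2 * ∫⁻ x, ‖x‖ₑ ^ 2 ∂ν) ?_ ?_
    · exact ENNReal.add_ne_top.2 ⟨ENNReal.mul_ne_top ENNReal.ofNat_ne_top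
        (ENNReal.mul_ne_top (ENNReal.inv_ne_top.2 hb) hM),
        ENNReal.mul_ne_top ENNReal.ofNat_ne_top hν⟩
    · calc ∫⁻ x, ‖x‖ₑ ^ 2 * f x ∂π
          = ∫⁻ x, liminf (fun n => ‖x‖ₑ ^ 2 * fs n x) atTop ∂π := by
            refine lintegral_congr_ae ?_
            filter_upwards [hlim] with x hx
            exact (ENNReal.Tendsto.const_mul hx (Or.inr (by simp))).liminf_eq.symm
        _ ≤ liminf (fun n => ∫⁻ x, ‖x‖ₑ ^ 2 * fs n x ∂π) atTop :=
            lintegral_liminf_le fun n => by fun_prop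
        _ ≤ liminf (fun _ : ℕ => 2 * (b⁻¹ * M) + 2 * ∫⁻ x, ‖x‖ₑ ^ 2 ∂ν) atTop :=
            liminf_le_liminf (Eventually.of_forall hmoms)
        _ = _ := liminf_const _
  have hcost : b * transportCost (π.withDensity f) ν
      ≤ liminf (fun n => b * transportCost (π.withDensity (fs n)) ν) atTop := by
    rw [ENNReal.liminf_const_mul_of_ne_top hb']
    gcongr
    exact transportCost_withDensity_le_liminf hf hfs hft (by simp [hf1]) (by simp [hf1, hfs1])
      hlim hmom hν
  have hent : densityEntropy π f ≤ liminf (fun n => densityEntropy π (fs n)) atTop := by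
    refine le_trans (le_of_eq ?_) (lintegral_liminf_le fun n => by fun_prop)
    refine lintegral_congr_ae ?_
    filter_upwards [hlim] with x hx
    exact ((ENNReal.tendsto_ofReal ((continuous_klFun.tendsto _).comp
      ((ENNReal.tendsto_toReal (hft x)).comp hx))).liminf_eq).symm
  have hpot : ∫⁻ x, g x * f x ∂π ≤ liminf (fun n => ∫⁻ x, g x * fs n x ∂π) atTop := by
    refine le_trans (le_of_eq ?_) (lintegral_liminf_le fun n => by fun_prop)
    refine lintegral_congr_ae ?_
    filter_upwards [hlim] with x hx
    exact (ENNReal.Tendsto.const_mul hx (Or.inr (hgt x))).liminf_eq.symm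
  have hent' : a * densityEntropy π f ≤ liminf (fun n => a * densityEntropy π (fs n)) atTop := by
    rw [ENNReal.liminf_const_mul_of_ne_top ha]
    gcongr
  exact (add_le_add ((add_le_add hpot hent').trans (liminf_add_liminf_le _ _)) hcost).trans
    (liminf_add_liminf_le _ _)

/-- The entropic transport functional attains its minimum over the probability densities. -/
theorem exists_densityFunctional_minimizer [IsFiniteMeasure π] [IsFiniteMeasure ν]
    (hg : Measurable g) (hgt : ∀ x, g x ≠ ∞) (ha : a ≠ 0) (ha' : a ≠ ∞) (hb : b ≠ 0) (hb' : b ≠ ∞)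
    (hν : ∫⁻ x, ‖x‖ₑ ^ 2 ∂ν ≠ ∞) {f₀ : E → ℝ≥0∞} (hf₀ : Measurable f₀)
    (hf₀1 : ∫⁻ x, f₀ x ∂π = 1) (hfin : densityFunctional π ν g a b f₀ ≠ ∞) :
    ∃ f : E → ℝ≥0∞, Measurable f ∧ ∫⁻ x, f x ∂π = 1 ∧
      densityFunctional π ν g a b f ≠ ∞ ∧
      ∀ f' : E → ℝ≥0∞, Measurable f' → ∫⁻ x, f' x ∂π = 1 →
        densityFunctional π ν g a b f ≤ densityFunctional π ν g a b f' := by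
  set S : Set (E → ℝ≥0∞) := {f | Measurable f ∧ ∫⁻ x, f x ∂π = 1}
  set I := ⨅ f ∈ S, densityFunctional π ν g a b f with hI
  have hIle : ∀ f ∈ S, I ≤ densityFunctional π ν g a b f := fun f hf => iInf₂_le f hf
  have hIt : I ≠ ∞ := ne_top_of_le_ne_top hfin (hIle f₀ ⟨hf₀, hf₀1⟩)
  -- Tolerances matched to the convexity gain: two densities within δ N of the infimum are at
  -- squared Hellinger distance less than (2⁻ᴺ)², since their midpoint cannot go below I.
  set δ : ℕ → ℝ≥0∞ := fun n => a * 4⁻¹ * (2⁻¹ ^ n) ^ 2 with hδ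
  have ha4 : a * 4⁻¹ ≠ 0 := mul_ne_zero ha (by simp)
  have ha4' : a * 4⁻¹ ≠ ∞ := ENNReal.mul_ne_top ha' (by simp)
  have hδ0 : ∀ n, δ n ≠ 0 := fun n => mul_ne_zero ha4 (by simp)
  have hδanti : Antitone δ := fun m n hmn => by
    refine mul_le_mul_right (pow_le_pow_left₀ zero_le ?_ 2) _
    exact pow_le_pow_right_of_le_one' (by simp) hmn
  have hδlim : Tendsto δ atTop (𝓝 0) := by
    have h1 : Tendsto (fun n : ℕ => (2⁻¹ : ℝ≥0∞) ^ n) atTop (𝓝 0) :=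
      ENNReal.tendsto_pow_atTop_nhds_zero_of_lt_one (by simp)
    have h2 : Tendsto (fun n : ℕ => ((2⁻¹ : ℝ≥0∞) ^ n) ^ 2) atTop (𝓝 0) := by
      simpa [Function.comp_def] using ((ENNReal.continuous_pow 2).tendsto 0).comp h1
    simpa using ENNReal.Tendsto.const_mul h2 (Or.inr ha4')
  have hex : ∀ n, ∃ f ∈ S, densityFunctional π ν g a b f < I + δ n := fun n => by
    obtain ⟨f, hf⟩ := iInf_lt_iff.1 (ENNReal.lt_add_right hIt (hδ0 n))
    obtain ⟨hfS, hf⟩ := iInf_lt_iff.1 hf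
    exact ⟨f, hfS, hf⟩
  choose fs hfsS hfsI using hex
  have hae : ∀ f ∈ S, ∀ᵐ x ∂π, f x ≠ ∞ := fun f hf =>
    (ae_lt_top hf.1 (by simp [hf.2])).mono fun x hx => hx.ne
  have hcauchy : ∀ N n m, N ≤ n → N ≤ m → hellingerSq π (fs n) (fs m) < (2⁻¹ ^ N) ^ 2 := by
    intro N n m hn hm
    have hmid := densityFunctional_midpoint_le (ν := ν) (a := a) (b := b) hg (hfsS n).1 (hfsS m).1
      (hae _ (hfsS n)) (hae _ (hfsS m))
    have hImid := hIle _ ⟨((hfsS n).1.add (hfsS m).1).const_mul 2⁻¹,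
      lintegral_midpoint_eq_one (hfsS n).1 (hfsS n).2 (hfsS m).2⟩
    have hlt : I + a * 4⁻¹ * hellingerSq π (fs n) (fs m) < I + a * 4⁻¹ * (2⁻¹ ^ N) ^ 2 := by
      calc I + a * 4⁻¹ * hellingerSq π (fs n) (fs m)
          ≤ 2⁻¹ * (densityFunctional π ν g a b (fs n) + densityFunctional π ν g a b (fs m)) :=
            (add_le_add_left hImid _).trans hmid
        _ < 2⁻¹ * ((I + δ N) + (I + δ N)) := by
            refine (ENNReal.mul_lt_mul_iff_right (by simp) (by simp)).2 (ENNReal.add_lt_add ?_ ?_)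
            · exact (hfsI n).trans_le (by gcongr; exact hδanti hn)
            · exact (hfsI m).trans_le (by gcongr; exact hδanti hm)
        _ = I + δ N := by
            rw [← two_mul, ← mul_assoc, ENNReal.inv_mul_cancel two_ne_zero ENNReal.ofNat_ne_top,
              one_mul]
    exact lt_of_mul_lt_mul_left' (lt_of_add_lt_add_left hlt)
  obtain ⟨f, φ, hf, hft, hf1, hφ, hlim⟩ := exists_subseq_tendsto_of_hellingerSq_lt
    (fun n => (hfsS n).1) (fun n => (hfsS n).2) hcauchy
  have hfI : densityFunctional π ν g a b f ≤ I := by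
    refine (densityFunctional_le_liminf hg hgt ha' hb hb' hν hf (fun n => (hfsS (φ n)).1) hft hf1
      (fun n => (hfsS (φ n)).2) hlim (M := I + δ 0) ?_ fun n => ?_).trans ?_
    · exact ENNReal.add_ne_top.2 ⟨hIt, ENNReal.mul_ne_top ha4' (by simp)⟩
    · exact (hfsI _).le.trans (by gcongr; exact hδanti (Nat.zero_le _))
    · have hub : Tendsto (fun n => I + δ (φ n)) atTop (𝓝 I) := by
        simpa using (hδlim.comp hφ.tendsto_atTop).const_add I
      rw [← hub.liminf_eq]
      exact liminf_le_liminf (Eventually.of_forall fun n => (hfsI _).le)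
  exact ⟨f, hf, hf1, ne_top_of_le_ne_top hIt hfI, fun f' hf' hf1' => hfI.trans (hIle f' ⟨hf', hf1'⟩)⟩

end Existence

/-! ### From densities back to the Wasserstein space -/

namespace P2

variable {d : ℕ}

theorem W2_sq (μ ν : P2 d) : W2 μ ν ^ 2 = transportCost μ.toMeasure ν.toMeasure := by
  unfold W2
  rw [← ENNReal.rpow_natCast, ← ENNReal.rpow_mul]
  norm_num
  rfl

theorem exists_density {π μ : P2 d} (h : μ ∈ absCont π) :
    ∃ f : EuclideanSpace ℝ (Fin d) → ℝ≥0∞, Measurable f ∧ ∫⁻ x, f x ∂π.toMeasure = 1 ∧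
      μ.toMeasure = π.toMeasure.withDensity f := by
  have : μ.toMeasure.HaveLebesgueDecomposition π.toMeasure :=
    Measure.haveLebesgueDecomposition_of_sigmaFinite _ _
  have hμ := Measure.withDensity_rnDeriv_eq _ _ h
  refine ⟨_, Measure.measurable_rnDeriv μ.toMeasure π.toMeasure, ?_, hμ.symm⟩
  rw [Measure.lintegral_rnDeriv h, measure_univ]

/-- On a density, the prox-linear objective is a nonnegative functional plus a real constant. -/
theorem proxLinear_eq_densityFunctional {g : EuclideanSpace ℝ (Fin d) → ℝ} (hg : Continuous g)
    {C : ℝ} (hC : ∀ x, |g x| ≤ C) (σ τ : ℝ) (π μ₀ : P2 d) {μ : P2 d}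
    {f : EuclideanSpace ℝ (Fin d) → ℝ≥0∞} (hf : Measurable f)
    (hμ : μ.toMeasure = π.toMeasure.withDensity f) :
    proxLinear g σ τ π μ₀ μ = (densityFunctional π.toMeasure μ₀.toMeasure
        (fun x => ENNReal.ofReal (g x + C)) (ENNReal.ofReal σ) (ENNReal.ofReal (1 / (2 * τ))) f
          : EReal)
      + ((-C - ∫ x, g x ∂μ₀.toMeasure : ℝ) : EReal) := by
  have hint : Integrable g μ.toMeasure :=
    Integrable.of_bound hg.aestronglyMeasurable C (Eventually.of_forall hC)
  have hpos : ∀ x, 0 ≤ g x + C := fun x => by linarith [neg_le_of_abs_le (hC x)]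
  have hf1 : ∫⁻ x, f x ∂π.toMeasure = 1 := by
    rw [← setLIntegral_univ, ← withDensity_apply _ MeasurableSet.univ, ← hμ, measure_univ]
  -- Since μ has mass one, shifting the potential by C adds exactly C to its integral.
  have hpot : ∫⁻ x, ENNReal.ofReal (g x + C) * f x ∂π.toMeasure
      = ENNReal.ofReal (∫ x, g x ∂μ.toMeasure + C) := by
    have h1 : ∫ x, g x ∂μ.toMeasure + C = ∫ x, (g x + C) ∂μ.toMeasure := by
      rw [integral_add hint (integrable_const C)]
      simp
    rw [h1, ofReal_integral_eq_lintegral_ofReal (f := fun x => g x + C)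
      (hint.add (integrable_const C))
      (Eventually.of_forall hpos), hμ, lintegral_withDensity_eq_lintegral_mul _ hf
      (hg.measurable.add_const C).ennreal_ofReal]
    exact lintegral_congr fun x => mul_comm _ _
  have hnn : 0 ≤ ∫ x, g x ∂μ.toMeasure + C := by
    have h := norm_integral_le_of_norm_le_const (μ := μ.toMeasure) (f := g) (Eventually.of_forall hC)
    simp only [probReal_univ, mul_one] at h
    linarith [neg_le_of_abs_le h]
  have hreal : ((∫ x, g x ∂μ.toMeasure - ∫ x, g x ∂μ₀.toMeasure : ℝ) : EReal)
      = ((ENNReal.ofReal (∫ x, g x ∂μ.toMeasure + C) : ℝ≥0∞) : EReal)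
        + ((-C - ∫ x, g x ∂μ₀.toMeasure : ℝ) : EReal) := by
    rw [EReal.coe_ennreal_ofReal, max_eq_left hnn, ← EReal.coe_add]
    congr 1
    ring
  unfold proxLinear densityFunctional
  rw [hpot, W2_sq, hreal, hμ, klDiv_withDensity hf (by simp [hf1]), EReal.coe_ennreal_add,
    EReal.coe_ennreal_add]
  abel

/-- Finite cost to μ₀ forces a finite second moment, so minimizing over all probability densities
does not leave `P2`. -/
theorem exists_toMeasure_eq_withDensity {π μ₀ : P2 d} {g : EuclideanSpace ℝ (Fin d) → ℝ≥0∞}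
    {a b : ℝ≥0∞} (hb : b ≠ 0) {f : EuclideanSpace ℝ (Fin d) → ℝ≥0∞}
    (hf1 : ∫⁻ x, f x ∂π.toMeasure = 1)
    (hfin : densityFunctional π.toMeasure μ₀.toMeasure g a b f ≠ ∞) :
    ∃ μ : P2 d, μ.toMeasure = π.toMeasure.withDensity f := by
  refine ⟨⟨π.toMeasure.withDensity f, ⟨?_⟩, ?_⟩, rfl⟩
  · rw [withDensity_apply _ MeasurableSet.univ, setLIntegral_univ, hf1]
  · have hT : transportCost (π.toMeasure.withDensity f) μ₀.toMeasure ≠ ∞ := fun h => by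
      refine hfin ?_
      simp [densityFunctional, h, ENNReal.mul_top hb]
    refine (lintegral_enorm_sq_le_transportCost _ μ₀.toMeasure).trans_lt ?_
    exact ENNReal.add_lt_top.2 ⟨ENNReal.mul_lt_top ENNReal.ofNat_lt_top hT.lt_top,
      ENNReal.mul_lt_top ENNReal.ofNat_lt_top μ₀.secondMoment_lt_top⟩

/-- The competitor that makes the infimum finite is π itself: its entropy is zero and independent
coupling with μ₀ has finite cost. The measure μ₀ would not do, as its entropy may be infinite. -/
theorem densityFunctional_one_ne_top {π μ₀ : P2 d} {g : EuclideanSpace ℝ (Fin d) → ℝ≥0∞}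
    {a b M : ℝ≥0∞} (hM : M ≠ ∞) (hg : ∀ x, g x ≤ M) (hb : b ≠ ∞) :
    densityFunctional π.toMeasure μ₀.toMeasure g a b 1 ≠ ∞ := by
  have h1 : ∫⁻ x, g x * (1 : EuclideanSpace ℝ (Fin d) → ℝ≥0∞) x ∂π.toMeasure ≠ ∞ := by
    refine ne_top_of_le_ne_top hM ?_
    calc _ ≤ ∫⁻ _, M ∂π.toMeasure := lintegral_mono fun x => by simpa using hg x
      _ = M := by simp
  have h2 : densityEntropy π.toMeasure 1 = 0 := by simp [densityEntropy, klFun_one]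
  have h3 : transportCost π.toMeasure μ₀.toMeasure ≠ ∞ := by
    obtain ⟨γ, hγ₁, hγ₂, hγ⟩ := exists_coupling_le (α := π.toMeasure) (β := μ₀.toMeasure) (by simp)
    refine ne_top_of_le_ne_top ?_ ((transportCost_le hγ₁ hγ₂).trans hγ)
    exact ENNReal.add_ne_top.2 ⟨ENNReal.mul_ne_top ENNReal.ofNat_ne_top π.secondMoment_lt_top.ne,
      ENNReal.mul_ne_top ENNReal.ofNat_ne_top μ₀.secondMoment_lt_top.ne⟩
  unfold densityFunctional
  rw [h2, withDensity_one, mul_zero, add_zero]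
  exact ENNReal.add_ne_top.2 ⟨h1, ENNReal.mul_ne_top hb h3⟩

/-- The prox-linear objective of a bounded continuous potential has a unique minimizer. -/
theorem existsUnique_isMinOn_proxLinear {g : EuclideanSpace ℝ (Fin d) → ℝ} (hg : Continuous g)
    {C : ℝ} (hC : ∀ x, |g x| ≤ C) {σ τ : ℝ} (hσ : 0 < σ) (hτ : 0 < τ) (π μ₀ : P2 d) :
    ∃! μ₁ : P2 d, μ₁ ∈ absCont π ∧ IsMinOn (proxLinear g σ τ π μ₀) (absCont π) μ₁ := by
  set G : EuclideanSpace ℝ (Fin d) → ℝ≥0∞ := fun x => ENNReal.ofReal (g x + C)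
  set a := ENNReal.ofReal σ
  set b := ENNReal.ofReal (1 / (2 * τ))
  set Φ := densityFunctional π.toMeasure μ₀.toMeasure G a b
  have hG : Measurable G := (hg.measurable.add_const C).ennreal_ofReal
  have ha : a ≠ 0 := (ENNReal.ofReal_pos.2 hσ).ne'
  have hb : b ≠ 0 := (ENNReal.ofReal_pos.2 (by positivity)).ne'
  -- The two objectives differ by the same real constant for every competitor, and a real constant
  -- cancels in `EReal` even when the values are infinite.
  have hcmp : ∀ {μ μ' : P2 d} {f f' : EuclideanSpace ℝ (Fin d) → ℝ≥0∞}, Measurable f →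
      Measurable f' → μ.toMeasure = π.toMeasure.withDensity f →
      μ'.toMeasure = π.toMeasure.withDensity f' →
      (proxLinear g σ τ π μ₀ μ ≤ proxLinear g σ τ π μ₀ μ' ↔ Φ f ≤ Φ f') := by
    intro μ μ' f f' hf hf' hμ hμ'
    rw [proxLinear_eq_densityFunctional hg hC σ τ π μ₀ hf hμ,
      proxLinear_eq_densityFunctional hg hC σ τ π μ₀ hf' hμ',
      (EReal.addLECancellable_coe _).add_le_add_iff_right, EReal.coe_ennreal_le_coe_ennreal_iff]
  have hone : Φ 1 ≠ ∞ := densityFunctional_one_ne_top (M := ENNReal.ofReal (C + C))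
    ENNReal.ofReal_ne_top (fun x => ENNReal.ofReal_le_ofReal (by linarith [le_of_abs_le (hC x)]))
    ENNReal.ofReal_ne_top
  obtain ⟨f, hf, hf1, hft, hmin⟩ := exists_densityFunctional_minimizer hG
    (fun x => ENNReal.ofReal_ne_top) ha ENNReal.ofReal_ne_top hb ENNReal.ofReal_ne_top
    μ₀.secondMoment_lt_top.ne measurable_one (by simp) hone
  obtain ⟨μ₁, hμ₁⟩ := exists_toMeasure_eq_withDensity hb hf1 hft
  have hμ₁π : μ₁ ∈ absCont π := by
    change μ₁.toMeasure ≪ π.toMeasure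
    rw [hμ₁]
    exact withDensity_absolutelyContinuous _ _
  refine ⟨μ₁, ⟨hμ₁π, fun μ hμ => ?_⟩, ?_⟩
  · obtain ⟨f', hf', hf1', hμf'⟩ := exists_density hμ
    exact (hcmp hf hf' hμ₁ hμf').2 (hmin f' hf' hf1')
  · rintro μ ⟨hμ, hμmin⟩
    obtain ⟨f', hf', hf1', hμf'⟩ := exists_density hμ
    have heq : Φ f' = Φ f := le_antisymm ((hcmp hf' hf hμf' hμ₁).1 (hμmin hμ₁π)) (hmin f' hf' hf1')
    have hae := ae_eq_of_densityFunctional_minimizers hG ha hf hf'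
      ((ae_lt_top hf (by simp [hf1])).mono fun x hx => hx.ne)
      ((ae_lt_top hf' (by simp [hf1'])).mono fun x hx => hx.ne) hft heq
      (hmin _ ((hf.add hf').const_mul 2⁻¹) (lintegral_midpoint_eq_one hf hf1 hf1'))
    exact P2.ext (by rw [hμ₁, hμf', withDensity_congr_ae hae])

end P2

theorem mainTheorem4 (d : ℕ) (σ τ : ℝ) (hσ : 0 < σ) (hτ : 0 < τ)
    (F : P2 d → ℝ) (D : P2 d → EuclideanSpace ℝ (Fin d) → ℝ) (hD : P2.IsFlatDerivative F D)
    (hbdd : ∃ C : ℝ, 0 < C ∧ ∀ μ x, |D μ x| ≤ C)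
    (π μ₀ : P2 d) (hμ₀ : μ₀ ∈ P2.absCont π) :
    ∃! μ₁ : P2 d, μ₁ ∈ P2.absCont π ∧
      IsMinOn (P2.proxLinear (D μ₀) σ τ π μ₀) (P2.absCont π) μ₁ := by
  obtain ⟨C, -, hC⟩ := hbdd
  exact P2.existsUnique_isMinOn_proxLinear
    (hD.continuous.comp (Continuous.prodMk_right μ₀)) (hC μ₀) hσ hτ π μ₀
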